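/- A residuated lattice that is commutative is written in the signature $(\wedge,\vee,\cdot,\to,e)$, where $xy\le z \iff y\le x\to z$. A De Morgan monoid is an algebra $(A,\wedge,\vee,\cdot,\to,e,f)$ whose $f$-free reduct is a commutative residuated lattice with distributive lattice reduct, satisfying $x\le x\cdot x$ and $(x\to f)\to f= x$. It is semilinear if it is a subdirect product of totally ordered De Morgan monoids; $\mathsf{SDMM}$ denotes the class of semilinear De Morgan monoids. A variety is a class of similar algebras closed under homomorphic images, subalgebras (up to isomorphism) and direct products, and $V(\mathbf A)$ is the least variety containing $\mathbf A$. A class $\mathsf K$ has the amalgamation property (AP) if for all injective homomorphisms $\varphi_1:\mathbf A\to\mathbf B$, $\varphi_2:\mathbf A\to\mathbf C$ between members of $\mathsf K$ there are $\mathbf D\in\mathsf K$ and injective homomorphisms $\psi_1:\mathbf B\to\mathbf D$, $\psi_2:\mathbf C\to\mathbf D$ with $\psi_1\varphi_1=\psi_2\varphi_2$. Let $\Omega(\mathsf{SDMM})$ be the set of varieties contained in $\mathsf{SDMM}$ that have the AP. For a prime $p$, let $\mathbf M_p$ be the algebra with universe $M_p=\{0,1,2,2^2,\ldots,2^p,2^{p+1}\}$,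 whose lattice operations are given by the usual order of the integers, whose product is $x\cdot y=\min(xy,2^{p+1})$, where $x\to y$ is the greatest $z\in M_p$ with $x\cdot z\le y$, and where $e=1$ and $f=2^p$. Proposition 5.3. 1. For each prime $p$, $\mathbf M_p$ is a totally ordered De Morgan monoid and a simple algebra (it is non-trivial, and its only congruences are the equality and the total relation). 2. For each prime $p$, $\mathbf M_p$ has exactly one non-trivial proper subalgebra, namely the one with universe $\{0,1,2^p,2^{p+1}\}$. 3. For each prime $p$, $V(\mathbf M_p)$ is a variety of semilinear De Morgan monoids with the AP. 4. If $p\ne q$ are primes, then $V(\mathbf M_p)\neq V(\mathbf M_q)$. 5. Consequently there are infinitely many varieties of semilinear De Morgan monoids with the AP, i.e. $\Omega(\mathsf{SDMM})$ is infinite. -/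

import Mathlib

universe w

namespace DeMorganAP

open FirstOrder FirstOrder.Language CategoryTheory

/-- The operation symbols of (commutative) residuated lattices with a negation constant:
meet, join, product, residual `→`, the unit `e` and the negation constant `f`. -/
inductive Op : ℕ → Type
  | meet : Op 2
  | join : Op 2
  | mul : Op 2
  | imp : Op 2
  | unit : Op 0
  | neg : Op 0

/-- The signature `(∧, ∨, ·, →, e, f)` of type `(2, 2, 2, 2, 0, 0)`. -/
def sig : FirstOrder.Language.{0, 0} := ⟨Op, fun _ => Empty⟩

instance : sig.IsAlgebraic := fun _ => (inferInstance : IsEmpty Empty)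

/-- Algebras of this signature, with underlying set in `Type w`. -/
abbrev Alg : Type (w + 1) := Bundled.{w} sig.Structure

section Operations

variable {A : Type w} [sig.Structure A]

def meet (x y : A) : A := Structure.funMap (L := sig) Op.meet ![x, y]
def join (x y : A) : A := Structure.funMap (L := sig) Op.join ![x, y]
def mul (x y : A) : A := Structure.funMap (L := sig) Op.mul ![x, y]
def imp (x y : A) : A := Structure.funMap (L := sig) Op.imp ![x, y]
variable (A) in
def unit : A := Structure.funMap (L := sig) Op.unit ![]
variable (A) in
def neg : A := Structure.funMap (L := sig) Op.neg ![]

/-- The lattice order: `x ≤ y` means `x ∧ y = x`. -/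
def le (x y : A) : Prop := meet x y = x

end Operations

/-- De Morgan monoids: commutative, distributive, involutive, square-increasing residuated
lattices. -/
structure IsDeMorganMonoid (A : Type w) [sig.Structure A] : Prop where
  meet_comm : ∀ x y : A, meet x y = meet y x
  meet_assoc : ∀ x y z : A, meet (meet x y) z = meet x (meet y z)
  join_comm : ∀ x y : A, join x y = join y x
  join_assoc : ∀ x y z : A, join (join x y) z = join x (join y z)
  meet_join_self : ∀ x y : A, meet x (join x y) = x
  join_meet_self : ∀ x y : A, join x (meet x y) = x
  meet_join_distrib : ∀ x y z : A, meet x (join y z) = join (meet x y) (meet x z)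
  mul_assoc : ∀ x y z : A, mul (mul x y) z = mul x (mul y z)
  mul_comm : ∀ x y : A, mul x y = mul y x
  unit_mul : ∀ x : A, mul (unit A) x = x
  residuation : ∀ x y z : A, le (mul x y) z ↔ le y (imp x z)
  square_increasing : ∀ x : A, le x (mul x x)
  involutive : ∀ x : A, imp (imp x (neg A)) (neg A) = x

def IsTotallyOrdered (A : Type w) [sig.Structure A] : Prop :=
  ∀ x y : A, le x y ∨ le y x

/-- `SDMM`: the De Morgan monoids that are subdirect products of totally ordered ones, i.e. that
admit a jointly injective family of surjective homomorphisms onto totally ordered ones. -/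
def SDMM : Set Alg.{w} :=
  {A | IsDeMorganMonoid A ∧
    ∃ (ι : Type w) (B : ι → Alg.{w}) (π : ∀ i, A →[sig] B i),
      (∀ i, IsDeMorganMonoid (B i) ∧ IsTotallyOrdered (B i)) ∧
      (∀ i, Function.Surjective (π i)) ∧
      ∀ x y : A, (∀ i, π i x = π i y) → x = y}

/-- The direct product, with coordinatewise operations. -/
def prod {ι : Type w} (A : ι → Alg.{w}) : Alg.{w} where
  α := ∀ i, A i
  str := { funMap := fun F x i => Structure.funMap F (fun j => x j i)
           RelMap := fun R => isEmptyElim R }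

/-- A variety: a class of algebras closed under homomorphic images, (isomorphic copies of)
subalgebras, and direct products. -/
structure IsVariety (K : Set Alg.{w}) : Prop where
  hom_image : ∀ (A B : Alg.{w}) (φ : A →[sig] B), A ∈ K → Function.Surjective φ → B ∈ K
  subalgebra : ∀ (A B : Alg.{w}), (A ↪[sig] B) → B ∈ K → A ∈ K
  product : ∀ (ι : Type w) (A : ι → Alg.{w}), (∀ i, A i ∈ K) → prod A ∈ K

/-- The least variety containing `K`. -/
def generatedVariety (K : Set Alg.{w}) : Set Alg.{w} :=
  {A | ∀ W : Set Alg.{w}, IsVariety W → K ⊆ W → A ∈ W}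

/-- `Ω(K)`: the varieties contained in `K` that have the amalgamation property. (For algebraic
signatures, an embedding `↪[sig]` is the same thing as an injective homomorphism.) -/
def Omega (K : Set Alg.{w}) : Set (Set Alg.{w}) :=
  {W | IsVariety W ∧ W ⊆ K ∧ Amalgamation W}

def IsCongruence (A : Type w) [sig.Structure A] (r : Setoid A) : Prop :=
  ∀ (n : ℕ) (F : sig.Functions n) (x y : Fin n → A),
    (∀ i, r (x i) (y i)) → r (Structure.funMap F x) (Structure.funMap F y)

/-- Simple algebras: non-trivial, with only the two trivial congruences. -/
def IsSimpleAlgebra (A : Type w) [sig.Structure A] : Prop :=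
  Nontrivial A ∧ ∀ r : Setoid A, IsCongruence A r → r = ⊥ ∨ r = ⊤

/-- The set `{0, 1, 2, 4, …, 2 ^ p, 2 ^ (p + 1)}`. -/
def carrier (p : ℕ) : Set ℕ := {n | n = 0 ∨ ∃ k ≤ p + 1, n = 2 ^ k}

theorem min_mem {p a b : ℕ} (ha : a ∈ carrier p) (hb : b ∈ carrier p) :
    min a b ∈ carrier p := by
  rcases min_choice a b with h | h <;> rw [h] <;> assumption

theorem max_mem {p a b : ℕ} (ha : a ∈ carrier p) (hb : b ∈ carrier p) :
    max a b ∈ carrier p := by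
  rcases max_choice a b with h | h <;> rw [h] <;> assumption

theorem two_pow_mem {p k : ℕ} (h : k ≤ p + 1) : 2 ^ k ∈ carrier p := Or.inr ⟨k, h, rfl⟩

theorem mul_mem {p a b : ℕ} (ha : a ∈ carrier p) (hb : b ∈ carrier p) :
    min (a * b) (2 ^ (p + 1)) ∈ carrier p := by
  rcases ha with rfl | ⟨i, hi, rfl⟩
  · left; simp
  rcases hb with rfl | ⟨j, hj, rfl⟩
  · left; simp
  rw [← pow_add]
  rcases le_total (i + j) (p + 1) with h | h
  · rw [min_eq_left (Nat.pow_le_pow_right (by norm_num) h)]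
    exact two_pow_mem h
  · rw [min_eq_right (Nat.pow_le_pow_right (by norm_num) h)]
    exact two_pow_mem le_rfl

theorem imp_mem {p a b : ℕ} (ha : a ∈ carrier p) (hb : b ∈ carrier p) :
    (if a = 0 ∨ b = 2 ^ (p + 1) then 2 ^ (p + 1) else b / a) ∈ carrier p := by
  split_ifs with h
  · exact two_pow_mem le_rfl
  rcases ha with rfl | ⟨i, hi, rfl⟩
  · simp at h
  rcases hb with rfl | ⟨j, hj, rfl⟩
  · left; simp
  rcases le_or_gt i j with hij | hij
  · rw [Nat.pow_div hij (by norm_num)]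
    exact two_pow_mem (by omega)
  · left
    exact Nat.div_eq_of_lt (Nat.pow_lt_pow_right (by norm_num) hij)

/-- The underlying set of the algebra `M_p`. -/
def M (p : ℕ) : Type := carrier p

/-- The operations of `M_p`. The lattice operations are those of the usual order of integers, the
product is the product of integers truncated at `2 ^ (p + 1)`, and `e = 1`, `f = 2 ^ p`. The
residual `x → y`, which is the greatest `z` with `x · z ≤ y`, is `2 ^ (p + 1)` if `x = 0` or
`y = 2 ^ (p + 1)`; otherwise it is the integer quotient `⌊y / x⌋`, which is the exact quotient if
`x ≤ y` and `0` if `y < x`. -/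
def funMapM (p : ℕ) : ∀ {n : ℕ}, Op n → (Fin n → M p) → M p
  | _, Op.meet, v => ⟨min (v 0).1 (v 1).1, min_mem (v 0).2 (v 1).2⟩
  | _, Op.join, v => ⟨max (v 0).1 (v 1).1, max_mem (v 0).2 (v 1).2⟩
  | _, Op.mul, v => ⟨min ((v 0).1 * (v 1).1) (2 ^ (p + 1)), mul_mem (v 0).2 (v 1).2⟩
  | _, Op.imp, v => ⟨if (v 0).1 = 0 ∨ (v 1).1 = 2 ^ (p + 1) then 2 ^ (p + 1)
      else (v 1).1 / (v 0).1, imp_mem (v 0).2 (v 1).2⟩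
  | _, Op.unit, _ => ⟨1, two_pow_mem (k := 0) (Nat.zero_le _)⟩
  | _, Op.neg, _ => ⟨2 ^ p, two_pow_mem (Nat.le_succ p)⟩

instance (p : ℕ) : sig.Structure (M p) where
  funMap := funMapM p
  RelMap := fun R => isEmptyElim R

/-- The variety `V(M_p)` (for algebras in `Type w`): the variety generated by the copy of `M_p`
in `Type w`. -/
def V (p : ℕ) : Set Alg.{w} :=
  generatedVariety {(Equiv.ulift.{w, 0} (α := M p)).symm.bundledInduced sig}

end DeMorganAP

/-!
For `p ≠ 0` the algebra `M p` has the term `(x → y) ∧ (y → x) ∧ e`, called `eqTest x y` here, whose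
value is `e` if `x = y` and the bottom element `0` otherwise. It makes `M p` a discriminator
algebra, and all of the universal algebra that is needed can be read off from it directly.

* Let `C` be an algebra whose points are separated by its homomorphisms to `M p`. A set of elements
  of `C` that take only the values `0` and `e`, and that is closed under products, behaves like a
  filter of a Boolean algebra. It generates a filter on the set of homomorphisms `C → M p`; the
  limit of the homomorphisms along an ultrafilter above it is again a homomorphism `C → M p`,
  because `M p` is finite (`exists_hom_of_filter`).
* Hence the algebras with enough homomorphisms to `M p` are closed under homomorphic images
  (`exists_hom_of_hom`), so they form the variety `V p` (`V_eq`). In particular the algebras in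
  `V p` are subdirect products of subalgebras of the totally ordered algebra `M p`.
* As `p` is prime, a subalgebra of `M p` that contains some `2 ^ i` with `0 < i < p` contains `2`
  (`val_two_mem_of_mem`), so is everything; and `2` is the only element whose `p`-th power is `f`.
  Hence two homomorphisms to `M p` are equal if the kernel of one is contained in that of the other
  (`hom_ext_of_ker_le`).
  Together with the ultrafilter argument it follows that `M p` is injective in `V p`
  (`exists_hom_extension`).
* Amalgamation follows: `B` and `C` over `A` embed into the power of `M p` that is indexed by the
  pairs of homomorphisms `B → M p`, `C → M p` that agree on `A`.
* A homomorphism `M p → M q` maps `2` to some `2 ^ j` with `j * p = q`, so the varieties for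
  different primes differ.
-/

namespace DeMorganAP

open FirstOrder FirstOrder.Language CategoryTheory

/-! ### Homomorphisms and terms -/

section Terms

theorem comp_pair {A B : Type*} (φ : A → B) (x y : A) : φ ∘ ![x, y] = ![φ x, φ y] := by
  ext i; fin_cases i <;> rfl

variable {A B : Type*} [sig.Structure A] [sig.Structure B]

theorem map_meet (φ : A →[sig] B) (x y : A) : φ (meet x y) = meet (φ x) (φ y) :=
  (φ.map_fun (n := 2) Op.meet ![x, y]).trans (congrArg _ (comp_pair φ x y))

theorem map_join (φ : A →[sig] B) (x y : A) : φ (join x y) = join (φ x) (φ y) :=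
  (φ.map_fun (n := 2) Op.join ![x, y]).trans (congrArg _ (comp_pair φ x y))

theorem map_mul (φ : A →[sig] B) (x y : A) : φ (mul x y) = mul (φ x) (φ y) :=
  (φ.map_fun (n := 2) Op.mul ![x, y]).trans (congrArg _ (comp_pair φ x y))

theorem map_imp (φ : A →[sig] B) (x y : A) : φ (imp x y) = imp (φ x) (φ y) :=
  (φ.map_fun (n := 2) Op.imp ![x, y]).trans (congrArg _ (comp_pair φ x y))

theorem map_unit (φ : A →[sig] B) : φ (unit A) = unit B :=
  (φ.map_fun (n := 0) Op.unit ![]).trans (congrArg _ (Subsingleton.elim _ _))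

theorem map_neg (φ : A →[sig] B) : φ (neg A) = neg B :=
  (φ.map_fun (n := 0) Op.neg ![]).trans (congrArg _ (Subsingleton.elim _ _))

variable (A) in
/-- The constant term `f · f → f`, whose value in `M p` is the bottom element if `p ≠ 0`. -/
def zero : A := imp (mul (neg A) (neg A)) (neg A)

/-- The term `(x → y) ∧ (y → x) ∧ e`. In `M p`, for `p ≠ 0`, it is `e` if `x = y` and `0`
otherwise. -/
def eqTest (x y : A) : A := meet (meet (imp x y) (imp y x)) (unit A)

/-- Powers with respect to the monoid operation `mul`. -/
def npow (x : A) : ℕ → A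
  | 0 => unit A
  | n + 1 => mul (npow x n) x

theorem map_zero (φ : A →[sig] B) : φ (zero A) = zero B := by
  simp only [zero, map_imp, map_mul, map_neg]

theorem map_eqTest (φ : A →[sig] B) (x y : A) : φ (eqTest x y) = eqTest (φ x) (φ y) := by
  simp only [eqTest, map_imp, map_meet, map_unit]

theorem map_npow (φ : A →[sig] B) (x : A) (n : ℕ) : φ (npow x n) = npow (φ x) n := by
  induction n with
  | zero => exact map_unit φ
  | succ n ih => rw [npow, map_mul, ih, npow]

theorem mul_mem' (S : sig.Substructure A) {x y : A} (hx : x ∈ S) (hy : y ∈ S) : mul x y ∈ S :=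
  S.fun_mem (n := 2) Op.mul _ (Fin.forall_fin_two.2 ⟨hx, hy⟩)

theorem imp_mem' (S : sig.Substructure A) {x y : A} (hx : x ∈ S) (hy : y ∈ S) : imp x y ∈ S :=
  S.fun_mem (n := 2) Op.imp _ (Fin.forall_fin_two.2 ⟨hx, hy⟩)

theorem unit_mem (S : sig.Substructure A) : unit A ∈ S :=
  S.fun_mem (n := 0) Op.unit _ finZeroElim

theorem neg_mem (S : sig.Substructure A) : neg A ∈ S :=
  S.fun_mem (n := 0) Op.neg _ finZeroElim

theorem zero_mem (S : sig.Substructure A) : zero A ∈ S :=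
  imp_mem' S (mul_mem' S (neg_mem S) (neg_mem S)) (neg_mem S)

theorem npow_mem (S : sig.Substructure A) {x : A} (hx : x ∈ S) (n : ℕ) : npow x n ∈ S := by
  induction n with
  | zero => exact unit_mem S
  | succ n ih => exact mul_mem' S ih hx

/-- De Morgan monoids are axiomatized by equations and equivalences between equations, which are
inherited by subdirect products. -/
theorem IsDeMorganMonoid.of_separating {ι : Type*} {B : ι → Type*} [∀ i, sig.Structure (B i)]
    (φ : ∀ i, A →[sig] B i) (hφ : ∀ x y : A, (∀ i, φ i x = φ i y) → x = y)
    (hB : ∀ i, IsDeMorganMonoid (B i)) : IsDeMorganMonoid A := by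
  have hle (x y : A) : le x y ↔ ∀ i, le (φ i x) (φ i y) := by
    simp only [le, ← map_meet]
    exact ⟨fun h i => congrArg (φ i) h, hφ _ _⟩
  constructor
  · exact fun x y => hφ _ _ fun i => by simp only [map_meet, (hB i).meet_comm (φ i x)]
  · exact fun x y z => hφ _ _ fun i => by simp only [map_meet, (hB i).meet_assoc]
  · exact fun x y => hφ _ _ fun i => by simp only [map_join, (hB i).join_comm (φ i x)]
  · exact fun x y z => hφ _ _ fun i => by simp only [map_join, (hB i).join_assoc]
  · exact fun x y => hφ _ _ fun i => by simp only [map_join, map_meet, (hB i).meet_join_self]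
  · exact fun x y => hφ _ _ fun i => by simp only [map_join, map_meet, (hB i).join_meet_self]
  · exact fun x y z => hφ _ _ fun i => by
      simp only [map_join, map_meet, (hB i).meet_join_distrib]
  · exact fun x y z => hφ _ _ fun i => by simp only [map_mul, (hB i).mul_assoc]
  · exact fun x y => hφ _ _ fun i => by simp only [map_mul, (hB i).mul_comm (φ i x)]
  · exact fun x => hφ _ _ fun i => by simp only [map_mul, map_unit, (hB i).unit_mul]
  · exact fun x y z => by simp only [hle, map_mul, map_imp, (hB _).residuation]
  · exact fun x => by simpa only [hle, map_mul] using fun i => (hB i).square_increasing _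
  · exact fun x => hφ _ _ fun i => by simp only [map_imp, map_neg, (hB i).involutive]

theorem IsTotallyOrdered.of_injective (φ : A →[sig] B) (hφ : Function.Injective φ)
    (hB : IsTotallyOrdered B) : IsTotallyOrdered A := by
  intro x y
  have := hB (φ x) (φ y)
  simpa only [le, ← map_meet, hφ.eq_iff] using this

end Terms

/-! ### Products and copies in other universes -/

/-- The copy in `Type w` of a small algebra. -/
def lift (A : Type) [sig.Structure A] : Alg.{w} :=
  (Equiv.ulift.{w, 0} (α := A)).symm.bundledInduced sig

/-- The isomorphism of a small algebra with its copy in `Type w`. -/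
def liftEquiv (A : Type) [sig.Structure A] : A ≃[sig] lift.{w} A :=
  (Equiv.ulift.{w, 0} (α := A)).symm.bundledInducedEquiv sig

/-- The homomorphism to a direct product with given coordinates. -/
def prodLift {ι : Type w} {A : Type w} [sig.Structure A] {B : ι → Alg.{w}}
    (φ : ∀ i, A →[sig] B i) : A →[sig] prod B where
  toFun x i := φ i x
  map_fun' F x := funext fun i => (φ i).map_fun F x
  map_rel' R := isEmptyElim R

/-- The coordinate projections of a direct product. -/
def prodProj {ι : Type w} (B : ι → Alg.{w}) (i : ι) : prod B →[sig] B i where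
  toFun x := x i
  map_fun' _ _ := rfl
  map_rel' R := isEmptyElim R

/-! ### The algebra `M p` -/

section Chain

variable {p : ℕ}

theorem val_meet (x y : M p) : (meet x y).1 = min x.1 y.1 := rfl
theorem val_mul (x y : M p) : (mul x y).1 = min (x.1 * y.1) (2 ^ (p + 1)) := rfl
theorem val_imp (x y : M p) : (imp x y).1 =
    if x.1 = 0 ∨ y.1 = 2 ^ (p + 1) then 2 ^ (p + 1) else y.1 / x.1 := rfl
theorem val_unit : (unit (M p)).1 = 1 := rfl
theorem val_neg : (neg (M p)).1 = 2 ^ p := rfl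

theorem M.ext {x y : M p} (h : x.1 = y.1) : x = y := Subtype.ext h

theorem le_iff (x y : M p) : le x y ↔ x.1 ≤ y.1 := by
  rw [le, ← min_eq_left_iff, ← val_meet]
  exact ⟨congrArg _, M.ext⟩

theorem val_cases (x : M p) : x.1 = 0 ∨ ∃ k ≤ p + 1, x.1 = 2 ^ k := x.2

theorem val_le (x : M p) : x.1 ≤ 2 ^ (p + 1) := by
  rcases val_cases x with h | ⟨k, hk, h⟩ <;> rw [h]
  · exact Nat.zero_le _
  · exact Nat.pow_le_pow_right two_pos hk

instance : Finite (M p) :=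
  Set.Finite.subset (Set.finite_Iic (2 ^ (p + 1))) fun n hn => val_le (⟨n, hn⟩ : M p)

theorem val_zero (hp : p ≠ 0) : (zero (M p)).1 = 0 := by
  have hff : (mul (neg (M p)) (neg (M p))).1 = 2 ^ (p + 1) := by
    rw [val_mul, val_neg, ← pow_add]
    exact min_eq_right (Nat.pow_le_pow_right two_pos (by omega))
  have hlt : 2 ^ p < 2 ^ (p + 1) := Nat.pow_lt_pow_right one_lt_two (Nat.lt_succ_self p)
  rw [zero, val_imp, hff, val_neg, if_neg (by simp)]
  exact Nat.div_eq_of_lt hlt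

theorem val_npow (x : M p) (n : ℕ) : (npow x n).1 = min (x.1 ^ n) (2 ^ (p + 1)) := by
  induction n with
  | zero => rw [npow, val_unit, pow_zero, min_eq_left Nat.one_le_two_pow]
  | succ n ih =>
    rw [npow, val_mul, ih, pow_succ x.1]
    rcases le_total (x.1 ^ n) (2 ^ (p + 1)) with h | h
    · rw [min_eq_left h]
    rw [min_eq_right h]
    rcases Nat.eq_zero_or_pos x.1 with h0 | h0
    · simp [h0]
    · rw [min_eq_right (Nat.le_mul_of_pos_right _ h0),
        min_eq_right (h.trans (Nat.le_mul_of_pos_right _ h0))]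

theorem isDeMorganMonoid_M (p : ℕ) : IsDeMorganMonoid (M p) := by
  constructor
  · exact fun x y => M.ext (min_comm _ _)
  · exact fun x y z => M.ext (min_assoc _ _ _)
  · exact fun x y => M.ext (max_comm _ _)
  · exact fun x y z => M.ext (max_assoc _ _ _)
  · exact fun x y => M.ext inf_sup_self
  · exact fun x y => M.ext sup_inf_self
  · exact fun x y z => M.ext (inf_sup_left _ _ _)
  · intro x y z
    apply M.ext
    simp only [val_mul]
    generalize 2 ^ (p + 1) = N
    -- truncating a factor is absorbed by the outer truncation
    have key (a b : ℕ) : min (min a N * b) N = min (a * b) N := by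
      rcases le_total a N with h | h
      · rw [min_eq_left h]
      rcases Nat.eq_zero_or_pos b with rfl | hb
      · simp
      rw [min_eq_right h, min_eq_right (Nat.le_mul_of_pos_right _ hb),
        min_eq_right (h.trans (Nat.le_mul_of_pos_right _ hb))]
    rw [key, Nat.mul_comm x.1 (min _ _), key, Nat.mul_comm _ x.1, Nat.mul_assoc]
  · exact fun x y => M.ext (by simp only [val_mul, Nat.mul_comm])
  · exact fun x => M.ext (by rw [val_mul, val_unit, one_mul, min_eq_left (val_le x)])
  · intro x y z
    rw [le_iff, le_iff, val_mul, val_imp]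
    have hy := val_le y
    have hz := val_le z
    split_ifs with h
    · simp only [hy, iff_true]
      rcases h with h | h
      · simp [h]
      · simp [h]
    · rw [not_or] at h
      rw [Nat.le_div_iff_mul_le (Nat.pos_of_ne_zero h.1), min_le_iff, Nat.mul_comm]
      have := lt_of_le_of_ne hz h.2
      exact ⟨fun h' => h'.resolve_right this.not_ge, Or.inl⟩
  · intro x
    rw [le_iff, val_mul]
    exact le_min (Nat.le_mul_self _) (val_le x)
  · intro x
    apply M.ext
    have hne : 2 ^ p ≠ 2 ^ (p + 1) := fun h => by
      have := Nat.pow_right_injective le_rfl h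
      omega
    have h2 : 2 ^ (p + 1) ≠ 0 := by positivity
    have hlt : 2 ^ p < 2 ^ (p + 1) := Nat.pow_lt_pow_right one_lt_two (Nat.lt_succ_self p)
    simp only [val_imp, val_neg, hne, or_false]
    rcases val_cases x with h | ⟨k, hk, h⟩ <;> rw [h]
    · rw [if_pos rfl, if_neg h2, Nat.div_eq_of_lt hlt]
    · rw [if_neg (by positivity : ¬ 2 ^ k = 0)]
      rcases hk.lt_or_eq with hk | rfl
      · have hk : k ≤ p := by omega
        rw [Nat.pow_div hk two_pos, if_neg (by positivity), Nat.pow_div (by omega) two_pos]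
        congr 1
        omega
      · rw [Nat.div_eq_of_lt hlt, if_pos rfl]

theorem isTotallyOrdered_M (p : ℕ) : IsTotallyOrdered (M p) := fun x y => by
  simpa only [le_iff] using le_total x.1 y.1

theorem eqTest_self (x : M p) : eqTest x x = unit (M p) := by
  apply M.ext
  rw [eqTest, val_meet, val_meet, min_self, val_unit, val_imp]
  apply min_eq_right
  split_ifs with h
  · exact Nat.one_le_two_pow
  · rw [Nat.div_self (by omega)]

theorem eqTest_of_ne (hp : p ≠ 0) {x y : M p} (h : x ≠ y) : eqTest x y = zero (M p) := by
  -- the residual of a larger element by a smaller one is `0`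
  have key {x y : M p} (h : x.1 < y.1) : (imp y x).1 = 0 := by
    have hx : x.1 ≠ 2 ^ (p + 1) := (h.trans_le (val_le y)).ne
    rw [val_imp, if_neg (by omega), Nat.div_eq_of_lt h]
  apply M.ext
  rw [eqTest, val_meet, val_meet, val_zero hp]
  rcases lt_or_gt_of_ne fun h' => h (M.ext h') with h | h <;> simp [key h]

theorem unit_ne_zero (hp : p ≠ 0) : unit (M p) ≠ zero (M p) := fun h => by
  have := congrArg Subtype.val h
  rw [val_unit, val_zero hp] at this
  omega

theorem eqTest_eq_unit (hp : p ≠ 0) {x y : M p} : eqTest x y = unit (M p) ↔ x = y := by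
  refine ⟨fun h => ?_, fun h => h ▸ eqTest_self x⟩
  by_contra hne
  exact unit_ne_zero hp (h.symm.trans (eqTest_of_ne hp hne))

theorem unit_mul (x : M p) : mul (unit (M p)) x = x := (isDeMorganMonoid_M p).unit_mul x

theorem zero_mul (hp : p ≠ 0) (x : M p) : mul (zero (M p)) x = zero (M p) := by
  apply M.ext
  simp [val_mul, val_zero hp]

/-- A congruence that identifies `a ≠ b` identifies `eqTest a b = 0` with `eqTest b b = e`, hence
`0 · x = 0` with `e · x = x` for all `x`. -/
theorem isSimpleAlgebra_M (hp : p ≠ 0) : IsSimpleAlgebra (M p) := by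
  refine ⟨⟨_, _, unit_ne_zero hp⟩, fun r hr => or_iff_not_imp_left.2 fun hbot => ?_⟩
  have hpair (F : Op 2) {x x' y y' : M p} (hx : r x x') (hy : r y y') :
      r (Structure.funMap (L := sig) F ![x, y]) (Structure.funMap (L := sig) F ![x', y']) :=
    hr 2 F _ _ (Fin.forall_fin_two.2 ⟨hx, hy⟩)
  obtain ⟨a, b, hab, hne⟩ : ∃ a b, r a b ∧ a ≠ b := by
    by_contra! h
    exact hbot (Setoid.ext fun a b => ⟨h a b, fun h' => h' ▸ r.refl a⟩)
  have h01 : r (zero (M p)) (unit (M p)) := by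
    rw [← eqTest_of_ne hp hne, ← eqTest_self b]
    exact hpair Op.meet (hpair Op.meet (hpair Op.imp hab (r.refl b)) (hpair Op.imp (r.refl b) hab))
      (r.refl _)
  have h0 (x : M p) : r (zero (M p)) x := by
    have := hpair Op.mul h01 (r.refl x)
    rwa [← mul, ← mul, zero_mul hp, unit_mul] at this
  exact Setoid.ext fun x y => ⟨fun _ => trivial, fun _ => r.trans (r.symm (h0 x)) (h0 y)⟩

/-! ### Subalgebras of `M p` and rigidity -/

/-- If `i` is the least positive exponent with `2 ^ i ∈ S`, then `i` divides `p`, because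
`2 ^ (p % i)` is the residual `(2 ^ i) ^ (p / i) → f`. -/
theorem val_two_mem_of_mem (hp : p.Prime) (S : sig.Substructure (M p)) {x : M p} (hx : x ∈ S)
    (hx' : x.1 ∉ ({0, 1, 2 ^ p, 2 ^ (p + 1)} : Set ℕ)) : ∃ y ∈ S, y.1 = 2 := by
  classical
  obtain ⟨k, hk, hxk⟩ := (val_cases x).resolve_left fun h => hx' (by simp [h])
  have hkp : 0 < k ∧ k < p := by
    rw [hxk] at hx'
    refine ⟨Nat.pos_of_ne_zero fun h => hx' (by simp [h]), ?_⟩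
    by_contra h
    have : k = p ∨ k = p + 1 := by omega
    rcases this with rfl | rfl <;> simp at hx'
  have hex : ∃ i, 0 < i ∧ ∃ y ∈ S, y.1 = 2 ^ i := ⟨k, hkp.1, x, hx, hxk⟩
  obtain ⟨hi, y, hy, hyi⟩ := Nat.find_spec hex
  have hmin (j : ℕ) (hj : 0 < j) (h : ∃ y ∈ S, y.1 = 2 ^ j) : Nat.find hex ≤ j :=
    Nat.find_min' hex ⟨hj, h⟩
  generalize Nat.find hex = i at hi hyi hmin
  have hik : i ≤ k := hmin k hkp.1 ⟨x, hx, hxk⟩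
  have hdiv : i * (p / i) + p % i = p := Nat.div_add_mod p i
  have hpow : (npow y (p / i)).1 = 2 ^ (i * (p / i)) := by
    rw [val_npow, hyi, ← pow_mul, min_eq_left]
    exact Nat.pow_le_pow_right two_pos (by omega)
  have hres : (imp (npow y (p / i)) (neg (M p))).1 = 2 ^ (p % i) := by
    have hne : 2 ^ p ≠ 2 ^ (p + 1) := (Nat.pow_lt_pow_right one_lt_two (Nat.lt_succ_self p)).ne
    have hpos : 2 ^ (i * (p / i)) ≠ 0 := by positivity
    rw [val_imp, hpow, val_neg, if_neg (not_or.2 ⟨hpos, hne⟩),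
      Nat.pow_div (by omega) two_pos]
    congr 1
    omega
  have hmod : p % i = 0 := by
    by_contra h
    have := hmin _ (Nat.pos_of_ne_zero h) ⟨_, imp_mem' S (npow_mem S hy _) (neg_mem S), hres⟩
    exact absurd (Nat.mod_lt p hi) (by omega)
  rcases hp.eq_one_or_self_of_dvd i (Nat.dvd_of_mod_eq_zero hmod) with rfl | rfl
  · exact ⟨y, hy, by simpa using hyi⟩
  · omega

theorem eq_npow_of_val_two {b x : M p} (hb : b.1 = 2) (hx : x.1 ≠ 0) : ∃ k, x = npow b k := by
  obtain ⟨k, hk, hxk⟩ := (val_cases x).resolve_left hx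
  refine ⟨k, M.ext ?_⟩
  rw [val_npow, hb, hxk, min_eq_left (Nat.pow_le_pow_right two_pos hk)]

theorem min_mul_mem_four {F a b : ℕ} (hF : 1 ≤ F) (ha : a ∈ ({0, 1, F, 2 * F} : Set ℕ))
    (hb : b ∈ ({0, 1, F, 2 * F} : Set ℕ)) :
    min (a * b) (2 * F) ∈ ({0, 1, F, 2 * F} : Set ℕ) := by
  simp only [Set.mem_insert_iff, Set.mem_singleton_iff] at *
  rcases hF.eq_or_lt with rfl | hF
  · rcases ha with rfl | rfl | rfl | rfl <;> rcases hb with rfl | rfl | rfl | rfl <;> simp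
  have h : a = 0 ∨ b = 0 ∨ a = 1 ∨ b = 1 ∨ (F ≤ a ∧ F ≤ b) := by omega
  rcases h with rfl | rfl | rfl | rfl | ⟨h, h'⟩
  · simp
  · simp
  · omega
  · omega
  · exact .inr (.inr (.inr (min_eq_right (Nat.mul_le_mul (hF.trans_le h) h'))))

theorem residual_mem_four {F a b : ℕ} (hF : 1 ≤ F) (ha : a ∈ ({0, 1, F, 2 * F} : Set ℕ))
    (hb : b ∈ ({0, 1, F, 2 * F} : Set ℕ)) :
    (if a = 0 ∨ b = 2 * F then 2 * F else b / a) ∈ ({0, 1, F, 2 * F} : Set ℕ) := by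
  simp only [Set.mem_insert_iff, Set.mem_singleton_iff] at *
  split_ifs with h
  · simp
  have h' : a = 1 ∨ a = b ∨ b < a := by omega
  rcases h' with rfl | rfl | h'
  · simpa using hb
  · exact .inr (.inl (Nat.div_self (by omega)))
  · exact .inl (Nat.div_eq_of_lt h')

variable (p) in
/-- The subalgebra `{0, 1, 2 ^ p, 2 ^ (p + 1)}` of `M p`. -/
def four : sig.Substructure (M p) where
  carrier := {x | x.1 ∈ ({0, 1, 2 ^ p, 2 ^ (p + 1)} : Set ℕ)}
  fun_mem := by
    have hF : 1 ≤ 2 ^ p := Nat.one_le_two_pow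
    have h2 : 2 ^ (p + 1) = 2 * 2 ^ p := by rw [pow_succ, Nat.mul_comm]
    intro n F v hv
    have hv (i : Fin n) : (v i).1 ∈ ({0, 1, 2 ^ p, 2 ^ (p + 1)} : Set ℕ) := hv i
    cases F with
    | meet =>
      change min (v 0).1 (v 1).1 ∈ ({0, 1, 2 ^ p, 2 ^ (p + 1)} : Set ℕ)
      rcases min_choice (v 0).1 (v 1).1 with h | h <;> rw [h]
      exacts [hv 0, hv 1]
    | join =>
      change max (v 0).1 (v 1).1 ∈ ({0, 1, 2 ^ p, 2 ^ (p + 1)} : Set ℕ)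
      rcases max_choice (v 0).1 (v 1).1 with h | h <;> rw [h]
      exacts [hv 0, hv 1]
    | mul =>
      change min ((v 0).1 * (v 1).1) (2 ^ (p + 1)) ∈ ({0, 1, 2 ^ p, 2 ^ (p + 1)} : Set ℕ)
      rw [h2] at hv ⊢
      exact min_mul_mem_four hF (hv 0) (hv 1)
    | imp =>
      change (if (v 0).1 = 0 ∨ (v 1).1 = 2 ^ (p + 1) then 2 ^ (p + 1) else (v 1).1 / (v 0).1) ∈
        ({0, 1, 2 ^ p, 2 ^ (p + 1)} : Set ℕ)
      rw [h2] at hv ⊢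
      exact residual_mem_four hF (hv 0) (hv 1)
    | unit => exact Or.inr (Or.inl rfl)
    | neg => exact Or.inr (Or.inr (Or.inl rfl))

/-- The top element of `M p` is `f · f`. -/
theorem val_neg_mul_neg (hp : p ≠ 0) : (mul (neg (M p)) (neg (M p))).1 = 2 ^ (p + 1) := by
  rw [val_mul, val_neg, ← pow_add]
  exact min_eq_right (Nat.pow_le_pow_right two_pos (by omega))

/-- The elements of `four p` are the values of constant terms. -/
theorem mem_four_iff (hp : p ≠ 0) {x : M p} : x ∈ four p ↔
    x = zero (M p) ∨ x = unit (M p) ∨ x = neg (M p) ∨ x = mul (neg (M p)) (neg (M p)) := by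
  have h (x y : M p) : x = y ↔ x.1 = y.1 := ⟨congrArg _, M.ext⟩
  rw [h, h, h, h, val_zero hp, val_neg_mul_neg hp]
  rfl

theorem four_le (hp : p ≠ 0) (S : sig.Substructure (M p)) : four p ≤ S := by
  intro x hx
  rcases (mem_four_iff hp).1 hx with rfl | rfl | rfl | rfl
  exacts [zero_mem S, unit_mem S, neg_mem S, mul_mem' S (neg_mem S) (neg_mem S)]

theorem four_ne_top (hp : p.Prime) : four p ≠ ⊤ := by
  intro h
  have h2 : (show M p from ⟨2, two_pow_mem (k := 1) (by omega)⟩) ∈ four p := by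
    rw [h]
    exact Set.mem_univ _
  have h2 : 2 = 0 ∨ 2 = 1 ∨ 2 = 2 ^ p ∨ 2 = 2 ^ (p + 1) := h2
  have h4 : 2 ^ 2 ≤ 2 ^ p := Nat.pow_le_pow_right two_pos hp.two_le
  omega

theorem nontrivial_and_ne_top_iff (hp : p.Prime) (S : sig.Substructure (M p)) :
    (Nontrivial S ∧ S ≠ ⊤) ↔ S = four p := by
  constructor
  · rintro ⟨-, hS⟩
    refine le_antisymm (fun x hx => ?_) (four_le hp.ne_zero S)
    by_contra hx4
    obtain ⟨b, hb, hb2⟩ := val_two_mem_of_mem hp S hx hx4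
    refine hS (eq_top_iff.2 fun y _ => ?_)
    by_cases hy : y.1 = 0
    · rw [show y = zero (M p) from M.ext (hy.trans (val_zero hp.ne_zero).symm)]
      exact zero_mem S
    · obtain ⟨k, rfl⟩ := eq_npow_of_val_two hb2 hy
      exact npow_mem S hb k
  · rintro rfl
    exact ⟨⟨⟨_, unit_mem _⟩, ⟨_, zero_mem _⟩, fun h =>
      unit_ne_zero hp.ne_zero (congrArg Subtype.val h)⟩, four_ne_top hp⟩

/-- If the `n`-th power of an element is `f`, no truncation has occurred. -/
theorem exists_of_npow_eq_neg {n : ℕ} (hn : n ≠ 0) {x : M p} (h : npow x n = neg (M p)) :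
    ∃ j, x.1 = 2 ^ j ∧ j * n = p := by
  have h := congrArg Subtype.val h
  rw [val_npow, val_neg] at h
  have hlt : 2 ^ p < 2 ^ (p + 1) := Nat.pow_lt_pow_right one_lt_two (Nat.lt_succ_self p)
  have h : x.1 ^ n = 2 ^ p := by omega
  rcases val_cases x with hx | ⟨j, -, hx⟩ <;> rw [hx] at h
  · rw [zero_pow hn] at h
    exact absurd h.symm (by positivity)
  · exact ⟨j, hx, Nat.pow_right_injective le_rfl (by simpa only [pow_mul] using h)⟩

/-- Homomorphisms to `M p` are determined by their kernels, since the subalgebras of `M p` are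
rigid. -/
theorem hom_ext_of_ker_le (hp : p.Prime) {A : Type*} [sig.Structure A] (h k : A →[sig] M p)
    (hker : ∀ a b, h a = h b → k a = k b) (a : A) : h a = k a := by
  have hp0 := hp.ne_zero
  -- it is enough to find a common term value for `h a` in `h` and `k`
  by_cases h4 : h.range ≤ four p
  · rcases (mem_four_iff hp0).1 (h4 ⟨a, rfl⟩) with ha | ha | ha | ha
    · rw [ha, ← map_zero k, ← hker a (zero A) (by rw [ha, map_zero])]
    · rw [ha, ← map_unit k, ← hker a (unit A) (by rw [ha, map_unit])]
    · rw [ha, ← map_neg k, ← hker a (neg A) (by rw [ha, map_neg])]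
    · rw [ha, ← map_neg k, ← map_mul,
        ← hker a (mul (neg A) (neg A)) (by rw [ha, map_mul, map_neg])]
  · obtain ⟨x, hx, hx4⟩ := SetLike.not_le_iff_exists.1 h4
    obtain ⟨_, ⟨b, rfl⟩, hb⟩ := val_two_mem_of_mem hp _ hx hx4
    have hkb : k b = h b := by
      have hbp : h (npow b p) = h (neg A) := by
        apply M.ext
        rw [map_npow, map_neg, val_npow, hb, val_neg]
        exact min_eq_left (Nat.pow_le_pow_right two_pos (Nat.le_succ p))
      have := hker _ _ hbp
      rw [map_npow, map_neg] at this
      obtain ⟨j, hj, hjp⟩ := exists_of_npow_eq_neg hp0 this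
      have hj1 : j = 1 := Nat.eq_of_mul_eq_mul_right hp.pos (by omega)
      exact M.ext (by rw [hj, hb, hj1, pow_one])
    by_cases ha : (h a).1 = 0
    · have ha : h a = zero (M p) := M.ext (ha.trans (val_zero hp0).symm)
      rw [ha, ← map_zero k, ← hker a (zero A) (by rw [ha, map_zero])]
    · obtain ⟨n, hn⟩ := eq_npow_of_val_two hb ha
      rw [hn, hker a (npow b n) (by rw [hn, map_npow]), map_npow, hkb]

end Chain

/-! ### Limits of homomorphisms -/

section Limits

variable {p : ℕ}

/-- The limit of homomorphisms to the finite algebra `M p` along an ultrafilter. -/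
theorem exists_limit {C : Type*} [sig.Structure C] (U : Ultrafilter (C →[sig] M p)) :
    ∃ k : C →[sig] M p, ∀ c, ∀ᶠ i : C →[sig] M p in U, i c = k c := by
  have hlim (c : C) : ∃ m : M p, ∀ᶠ i : C →[sig] M p in U, i c = m := by
    obtain ⟨m, hm⟩ := (U.map fun i => i c).eq_pure_of_finite
    have : ({m} : Set (M p)) ∈ U.map fun i => i c := hm ▸ Set.mem_singleton m
    exact ⟨m, this⟩
  choose k hk using hlim
  refine ⟨⟨k, fun {n} F x => ?_, fun R => isEmptyElim R⟩, hk⟩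
  have h : ∀ᶠ i : C →[sig] M p in U, ∀ j, i (x j) = k (x j) :=
    Filter.eventually_all.2 fun j => hk (x j)
  obtain ⟨i, hi, hi'⟩ := (h.and (hk (Structure.funMap F x))).exists
  rw [← hi', i.map_fun]
  exact congrArg _ (funext hi)

/-- The points of `C` are separated by homomorphisms to `M p`, i.e. `C` embeds into a power of
`M p`. -/
def Separated (p : ℕ) (C : Type*) [sig.Structure C] : Prop :=
  ∀ x y : C, (∀ k : C →[sig] M p, k x = k y) → x = y

variable {C : Type*} [sig.Structure C]

/-- The equation `eqTest t e = t` says that `t` only takes the values `0` and `e` under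
homomorphisms to `M p`. A set `T` of such elements that is closed under products is thus a filter base for the
homomorphisms that map a member of `T` to `e`. If `c` and `c'` remain different on multiplication
with any member of `T`, this filter does not exclude the homomorphisms that separate them. -/
theorem exists_hom_of_filter (hp : p ≠ 0) (hC : Separated p C) (T : Set C) (hT : unit C ∈ T)
    (hmul : ∀ s ∈ T, ∀ t ∈ T, mul s t ∈ T) (h01 : ∀ t ∈ T, eqTest t (unit C) = t) (c c' : C)
    (hc : ∀ t ∈ T, mul t c ≠ mul t c') :
    ∃ k : C →[sig] M p, (∀ t ∈ T, k t = unit (M p)) ∧ k c ≠ k c' := by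
  have hval (t) (ht : t ∈ T) (i : C →[sig] M p) : i t = unit (M p) ∨ i t = zero (M p) := by
    refine or_iff_not_imp_left.2 fun h => ?_
    rw [← h01 t ht, map_eqTest, map_unit, eqTest_of_ne hp h]
  let s (t : T) : Set (C →[sig] M p) := {i | i t = unit (M p) ∧ i c ≠ i c'}
  have : Nonempty T := ⟨⟨_, hT⟩⟩
  have hdir : Directed (· ≥ ·) fun t : T => Filter.principal (s t) := by
    intro t t'
    refine ⟨⟨_, hmul _ t.2 _ t'.2⟩, ?_, ?_⟩ <;>
    · refine Filter.principal_mono.2 fun i hi => ⟨?_, hi.2⟩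
      have hi := hi.1
      rw [map_mul] at hi
      rcases hval _ t.2 i with h | h <;> rcases hval _ t'.2 i with h' | h' <;>
        simp_all [zero_mul hp, unit_mul, (unit_ne_zero hp).symm]
  have hne (t : T) : (Filter.principal (s t)).NeBot := by
    rw [Filter.principal_neBot_iff]
    by_contra! hs
    refine hc t t.2 (hC _ _ fun i => ?_)
    rw [map_mul, map_mul]
    rcases hval t t.2 i with h | h
    · have hi : i ∉ s t := hs ▸ Set.notMem_empty i
      rw [not_not.1 fun h' => hi ⟨h, h'⟩]
    · rw [h, zero_mul hp, zero_mul hp]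
  have hF := Filter.iInf_neBot_of_directed' hdir hne
  -- any ultrafilter above the generated filter will do
  obtain ⟨k, hk⟩ := exists_limit (Ultrafilter.of (⨅ t : T, Filter.principal (s t)))
  have hev (t) (ht : t ∈ T) : ∀ᶠ i in (Ultrafilter.of (⨅ t : T, Filter.principal (s t)) :
      Filter (C →[sig] M p)), i ∈ s ⟨t, ht⟩ :=
    Ultrafilter.of_le _ (Filter.mem_iInf_of_mem (⟨t, ht⟩ : T) (Filter.mem_principal_self _))
  refine ⟨k, fun t ht => ?_, fun h => ?_⟩
  · obtain ⟨i, hi, hi'⟩ := ((hev t ht).and (hk t)).exists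
    exact hi' ▸ hi.1
  · obtain ⟨i, hi, hi', hi''⟩ := ((hev _ hT).and ((hk c).and (hk c'))).exists
    exact hi.2 (hi'.trans (h.trans hi''.symm))

theorem Separated.unit_mul (hC : Separated p C) (c : C) : mul (unit C) c = c :=
  hC _ _ fun k => by rw [map_mul, map_unit, DeMorganAP.unit_mul]

theorem Separated.eqTest_self (hC : Separated p C) (c : C) : eqTest c c = unit C :=
  hC _ _ fun k => by rw [map_eqTest, map_unit, DeMorganAP.eqTest_self]

theorem Separated.eqTest_eqTest (hp : p ≠ 0) (hC : Separated p C) (a b : C) :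
    eqTest (eqTest a b) (unit C) = eqTest a b := by
  refine hC _ _ fun k => ?_
  rw [map_eqTest, map_eqTest, map_unit]
  by_cases h : k a = k b
  · rw [h, DeMorganAP.eqTest_self, DeMorganAP.eqTest_self]
  · rw [eqTest_of_ne hp h, eqTest_of_ne hp (unit_ne_zero hp).symm]

theorem Separated.eqTest_mul_unit (hp : p ≠ 0) (hC : Separated p C) {s t : C}
    (hs : eqTest s (unit C) = s) (ht : eqTest t (unit C) = t) :
    eqTest (mul s t) (unit C) = mul s t := by
  refine hC _ _ fun k => ?_
  have hs := congrArg k hs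
  have ht := congrArg k ht
  rw [map_eqTest, map_unit] at *
  rw [map_mul]
  by_cases h : k s = unit (M p)
  · rwa [h, DeMorganAP.unit_mul]
  · rw [eqTest_of_ne hp h] at hs
    rw [← hs, zero_mul hp, eqTest_of_ne hp (unit_ne_zero hp).symm]

/-- Two points with different images under a homomorphism `φ` are separated by a homomorphism to
`M p` that factors through `φ`. -/
theorem exists_hom_of_hom (hp : p ≠ 0) (hC : Separated p C) {B : Type*} [sig.Structure B]
    (φ : C →[sig] B) {c c' : C} (hc : φ c ≠ φ c') :
    ∃ k : C →[sig] M p, (∀ a b, φ a = φ b → k a = k b) ∧ k c ≠ k c' := by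
  obtain ⟨k, hk, hkc⟩ := exists_hom_of_filter hp hC
    {t | eqTest t (unit C) = t ∧ φ t = φ (unit C)} ⟨hC.eqTest_self _, rfl⟩
    (fun s hs t ht => ⟨hC.eqTest_mul_unit hp hs.1 ht.1, by
      rw [map_mul, hs.2, ht.2, ← map_mul, hC.unit_mul]⟩)
    (fun t ht => ht.1) c c' (fun t ht h => hc <| by
      have := congrArg φ h
      rwa [map_mul, map_mul, ht.2, ← map_mul, ← map_mul, hC.unit_mul, hC.unit_mul] at this)
  refine ⟨k, fun a b hab => ?_, hkc⟩
  have : k (eqTest a b) = unit (M p) := by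
    refine hk _ ⟨hC.eqTest_eqTest hp a b, ?_⟩
    rw [map_eqTest, hab, ← map_eqTest, hC.eqTest_self]
  rwa [map_eqTest, eqTest_eq_unit hp] at this

/-- `M p` is injective among the algebras that embed into its powers. -/
theorem exists_hom_extension (hp : p.Prime) (hC : Separated p C) {A : Type*} [sig.Structure A]
    (ι : A ↪[sig] C) (h : A →[sig] M p) : ∃ k : C →[sig] M p, ∀ a, k (ι a) = h a := by
  have hp0 := hp.ne_zero
  have hA : Separated p A := fun x y hxy =>
    ι.injective (hC _ _ fun k => hxy (k.comp ι.toHom))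
  have e0 (a) : ι.toHom a = ι a := rfl
  obtain ⟨k, hk, -⟩ := exists_hom_of_filter hp0 hC
    (ι '' {t | eqTest t (unit A) = t ∧ h t = unit (M p)})
    ⟨unit A, ⟨hA.eqTest_self _, map_unit h⟩, map_unit ι.toHom⟩
    (by
      rintro _ ⟨s, hs, rfl⟩ _ ⟨t, ht, rfl⟩
      exact ⟨mul s t, ⟨hA.eqTest_mul_unit hp0 hs.1 ht.1, by rw [map_mul, hs.2, ht.2, unit_mul]⟩,
        map_mul ι.toHom s t⟩)
    (by
      rintro _ ⟨t, ht, rfl⟩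
      rw [← e0, ← map_unit ι.toHom, ← map_eqTest, ht.1])
    (unit C) (zero C) (by
      rintro _ ⟨t, ht, rfl⟩ h0
      rw [← e0, ← map_unit ι.toHom, ← map_zero ι.toHom, ← map_mul, ← map_mul] at h0
      have := congrArg h (ι.injective h0)
      rw [map_mul, map_mul, ht.2, unit_mul, unit_mul, map_unit, map_zero] at this
      exact unit_ne_zero hp0 this)
  -- it remains to see that `k ∘ ι` identifies whatever `h` identifies
  refine ⟨k, fun a => (hom_ext_of_ker_le hp h (k.comp ι.toHom) (fun a b hab => ?_) a).symm⟩
  have : k (ι (eqTest a b)) = unit (M p) := by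
    refine hk _ ⟨_, ⟨hA.eqTest_eqTest hp0 a b, ?_⟩, rfl⟩
    rw [map_eqTest, hab, eqTest_self]
  rw [← e0, map_eqTest, map_eqTest, eqTest_eq_unit hp0] at this
  exact this

end Limits

/-! ### The variety generated by `M p` -/

section Variety

variable {p : ℕ}

theorem isVariety_separated (hp : p ≠ 0) : IsVariety {C : Alg.{w} | Separated p C} where
  hom_image A B φ hA hφ x y hxy := by
    obtain ⟨a, rfl⟩ := hφ x
    obtain ⟨b, rfl⟩ := hφ y
    by_contra hne
    obtain ⟨k, hk, hkab⟩ := exists_hom_of_hom hp hA φ hne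
    -- `k` factors through the surjection `φ`
    let g : B →[sig] M p :=
      { toFun := fun z => k (Function.surjInv hφ z)
        map_fun' := fun F v => by
          have h : k (Function.surjInv hφ (Structure.funMap F v)) =
              k (Structure.funMap F (Function.surjInv hφ ∘ v)) := by
            apply hk
            rw [Function.surjInv_eq hφ, φ.map_fun]
            exact congrArg _ (funext fun j => (Function.surjInv_eq hφ (v j)).symm)
          rw [h, k.map_fun]
          rfl
        map_rel' := fun R => isEmptyElim R }
    have hg (a : A) : g (φ a) = k a := hk _ _ (Function.surjInv_eq hφ _)
    exact hkab (by rw [← hg, ← hg, hxy g])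
  subalgebra A B ι hB x y hxy := ι.injective (hB _ _ fun k => hxy (k.comp ι.toHom))
  product ι A hA x y hxy := funext fun i =>
    hA i _ _ fun k => hxy (k.comp (prodProj A i))

theorem isVariety_generatedVariety (K : Set Alg.{w}) : IsVariety (generatedVariety K) where
  hom_image A B φ hA hφ W hW hK := hW.hom_image A B φ (hA W hW hK) hφ
  subalgebra A B ι hB W hW hK := hW.subalgebra A B ι (hB W hW hK)
  product ι A hA W hW hK := hW.product ι A fun i => hA i W hW hK

theorem separated_lift_M (p : ℕ) : Separated p (lift.{w} (M p)) := fun _ _ hxy =>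
  (liftEquiv (M p)).symm.injective (hxy (liftEquiv (M p)).symm.toHom)

/-- `V p` consists of the algebras that embed into powers of `M p`. -/
theorem V_eq (hp : p ≠ 0) : V.{w} p = {C : Alg.{w} | Separated p C} := by
  refine Set.Subset.antisymm (fun C hC => ?_) (fun C hC W hW hK => ?_)
  · exact hC _ (isVariety_separated hp) (Set.singleton_subset_iff.2 (separated_lift_M p))
  · refine hW.subalgebra C (prod fun _ : C →[sig] M p => lift (M p))
      (Embedding.ofInjective (f := prodLift fun k => (liftEquiv (M p)).toHom.comp k)
        fun x y hxy => hC _ _ fun k => ?_) (hW.product _ _ fun _ => hK rfl)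
    exact (liftEquiv (M p)).injective (congrFun hxy k)

theorem V_subset_SDMM (hp : p ≠ 0) : V.{w} p ⊆ SDMM.{w} := by
  rw [V_eq hp]
  intro C hC
  let e (k : C →[sig] M p) : lift.{w} k.range →[sig] M p :=
    k.range.subtype.toHom.comp (liftEquiv k.range).symm.toHom
  have he (k : C →[sig] M p) : Function.Injective (e k) :=
    k.range.subtype.injective.comp (liftEquiv k.range).symm.injective
  refine ⟨.of_separating (fun k : C →[sig] M p => k) hC fun _ => isDeMorganMonoid_M p,
    C →[sig] M p, fun k => lift k.range,
    fun k => (liftEquiv k.range).toHom.comp (k.codRestrict k.range fun c => ⟨c, rfl⟩),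
    fun k => ⟨.of_separating (fun _ : Unit => e k) (fun _ _ h => he k (h ())) fun _ =>
      isDeMorganMonoid_M p, .of_injective (e k) (he k) (isTotallyOrdered_M p)⟩,
    fun k => (liftEquiv k.range).surjective.comp ?_, fun x y hxy => hC _ _ fun k => ?_⟩
  · rintro ⟨_, c, rfl⟩
    exact ⟨c, rfl⟩
  · exact congrArg Subtype.val ((liftEquiv k.range).injective (hxy k))

theorem amalgamation_V (hp : p.Prime) : Amalgamation (V.{w} p) := by
  rw [V_eq hp.ne_zero]
  intro A B C ι κ _ hB hC
  let I := {hk : (B →[sig] M p) × (C →[sig] M p) // ∀ a, hk.1 (ι a) = hk.2 (κ a)}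
  let D : Alg.{w} := prod fun _ : I => lift (M p)
  refine ⟨D,
    Embedding.ofInjective (f := prodLift fun i : I => (liftEquiv (M p)).toHom.comp i.1.1)
      fun x y hxy => hB _ _ fun h => ?_,
    Embedding.ofInjective (f := prodLift fun i : I => (liftEquiv (M p)).toHom.comp i.1.2)
      fun x y hxy => hC _ _ fun k => ?_,
    (isVariety_separated hp.ne_zero).product _ _ fun _ => separated_lift_M p, ?_⟩
  · obtain ⟨k, hk⟩ := exists_hom_extension hp hC κ (h.comp ι.toHom)
    exact (liftEquiv (M p)).injective
      (congrFun hxy ⟨(h, k), fun a => (hk a).symm⟩)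
  · obtain ⟨h, hh⟩ := exists_hom_extension hp hB ι (k.comp κ.toHom)
    exact (liftEquiv (M p)).injective (congrFun hxy ⟨(h, k), hh⟩)
  · ext a
    exact funext fun i => congrArg (liftEquiv (M p)) (i.2 a)

/-- The element `2` of `M p` satisfies `2 ^ p = f`, so its image in `M q` is a `p`-th root
of `f`. -/
theorem eq_of_hom {q : ℕ} (hp : p.Prime) (hq : q.Prime) (k : M p →[sig] M q) : p = q := by
  let b : M p := ⟨2, two_pow_mem (k := 1) (by omega)⟩
  have hb : npow b p = neg (M p) := by
    apply M.ext
    rw [val_npow, val_neg]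
    exact min_eq_left (Nat.pow_le_pow_right two_pos (Nat.le_succ p))
  have := congrArg k hb
  rw [map_npow, map_neg] at this
  obtain ⟨j, -, hj⟩ := exists_of_npow_eq_neg hp.ne_zero this
  exact (Nat.prime_dvd_prime_iff_eq hp hq).1 ⟨j, by rw [← hj, Nat.mul_comm]⟩

theorem V_injOn : Set.InjOn V.{w} {p | p.Prime} := by
  intro p hp q hq hpq
  have h : Separated q (lift.{w} (M p)) := by
    have : lift (M p) ∈ V.{w} p := by
      rw [V_eq hp.ne_zero]
      exact separated_lift_M p
    rwa [hpq, V_eq hq.ne_zero] at this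
  by_contra hne
  -- without homomorphisms to `M q`, the algebra would be trivial
  refine unit_ne_zero hp.ne_zero ((liftEquiv.{w} (M p)).injective (h _ _ fun k => ?_))
  exact absurd (eq_of_hom hp hq (k.comp (liftEquiv (M p)).toHom)) hne

end Variety

end DeMorganAP

theorem proposition5p3 :
    (∀ p : ℕ, p.Prime →
      DeMorganAP.IsDeMorganMonoid (DeMorganAP.M p) ∧
      DeMorganAP.IsTotallyOrdered (DeMorganAP.M p) ∧
      DeMorganAP.IsSimpleAlgebra (DeMorganAP.M p) ∧
      (∃ S₀ : DeMorganAP.sig.Substructure (DeMorganAP.M p),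
        (S₀ : Set (DeMorganAP.M p)) = {x | x.1 ∈ ({0, 1, 2 ^ p, 2 ^ (p + 1)} : Set ℕ)} ∧
        ∀ S : DeMorganAP.sig.Substructure (DeMorganAP.M p),
          (Nontrivial S ∧ S ≠ ⊤) ↔ S = S₀) ∧
      DeMorganAP.IsVariety (DeMorganAP.V.{w} p) ∧
      DeMorganAP.V.{w} p ⊆ DeMorganAP.SDMM.{w} ∧
      FirstOrder.Language.Amalgamation (DeMorganAP.V.{w} p)) ∧
    (∀ p q : ℕ, p.Prime → q.Prime → p ≠ q → DeMorganAP.V.{w} p ≠ DeMorganAP.V.{w} q) ∧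
    (DeMorganAP.Omega DeMorganAP.SDMM.{w}).Infinite := by
  refine ⟨fun p hp => ⟨DeMorganAP.isDeMorganMonoid_M p, DeMorganAP.isTotallyOrdered_M p,
    DeMorganAP.isSimpleAlgebra_M hp.ne_zero,
    ⟨DeMorganAP.four p, rfl, DeMorganAP.nontrivial_and_ne_top_iff hp⟩,
    DeMorganAP.isVariety_generatedVariety _, DeMorganAP.V_subset_SDMM hp.ne_zero,
    DeMorganAP.amalgamation_V hp⟩, fun p q hp hq => DeMorganAP.V_injOn.ne hp hq, ?_⟩
  exact Set.infinite_of_injOn_mapsTo DeMorganAP.V_injOn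
    (fun p hp => ⟨DeMorganAP.isVariety_generatedVariety _, DeMorganAP.V_subset_SDMM hp.ne_zero,
      DeMorganAP.amalgamation_V hp⟩) Nat.infinite_setOfPred_prime
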